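/- Let $\Lambda(X,Y)=x_1y_3+x_2y_4-x_3y_1-x_4y_2$ be the standard symplectic form on $\mathbb R^4$. Let $\gamma:\mathbb R\to\mathbb R^4$ be a Lagrangian curve, i.e. a smooth curve such that $\gamma'(s),\gamma''(s)$ are linearly independent and $\Lambda(\gamma'(s),\gamma''(s))=0$ for all $s$. Suppose that $\gamma$ is parameterized by symplectic arc-length, i.e. $\Lambda(\gamma'',\gamma''')^{1/5}= 1$, and that its symplectic curvatures $\Lambda(\gamma''',\gamma^{(4)})=\kappa_3$ and $\Lambda(\gamma^{(4)},\gamma^{(5)})=\kappa_4$ are constant. Then $\gamma$ is closed (i.e. periodic) if and only if $\kappa_3>0$, $\kappa_3^2>\kappa_4>\tfrac34\kappa_3^2$, and there exist positive integers $m,n$ with $$\frac{\kappa_3^2}{(m^2+n^2)^2}=\frac{\kappa_4}{m^4+m^2n^2+n^4}.\qquad(*)$$ Suppose that $\gamma$ is closed, let $m,n$ be relatively prime positive integers satisfying $(*)$, and put $\nu=\sqrt{\tfrac12\big(\kappa_3-\sqrt{4\kappa_4-3\kappa_3^2}\big)}$. Then $\gamma$ is a torus knot of type $(m,n)$: it is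 a simple closed curve which lies on the image of a torus $x_1^2+x_3^2=r_1^2,\ x_2^2+x_4^2=r_2^2$ ($r_1,r_2>0$) under an affine symplectic transformation of $\mathbb R^4$ and which over one minimal period winds, up to sign, $m$ times around one circle factor of the torus and $n$ times around the other. Its symplectic length $\int_0^T\Lambda(\gamma'',\gamma''')^{1/5}\,ds$ over one minimal period $T$ is $$\frac{2\pi}{\nu\,\max(m,n)}\,\operatorname{lcm}(m,n).$$ -/

import Mathlib

open scoped ContDiff

/-- The space `ℝ⁴`. The coordinates `x₁, x₂, x₃, x₄` are indexed by
`inl 0, inl 1, inr 0, inr 1`. -/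
abbrev R4 : Type := Fin 2 ⊕ Fin 2 → ℝ

/-- The standard symplectic form `Λ(X, Y) = x₁y₃ + x₂y₄ - x₃y₁ - x₄y₂`, i.e. `ᵗX J Y` for
`J = (0 I; -I 0)`, which is minus Mathlib's `Matrix.J`. -/
noncomputable def symplForm (X Y : R4) : ℝ :=
  X ⬝ᵥ Matrix.mulVec (-Matrix.J (Fin 2) ℝ) Y

theorem symplForm_apply (X Y : R4) :
    symplForm X Y = X (Sum.inl 0) * Y (Sum.inr 0) + X (Sum.inl 1) * Y (Sum.inr 1)
      - X (Sum.inr 0) * Y (Sum.inl 0) - X (Sum.inr 1) * Y (Sum.inl 1) := by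
  simp [symplForm, Matrix.J, Matrix.neg_mulVec, Matrix.fromBlocks_mulVec, dotProduct]
  ring

/-- The `i`-th symplectic curvature `κᵢ = Λ(γ⁽ⁱ⁾, γ⁽ⁱ⁺¹⁾)` of a parameterized curve. -/
noncomputable def symplCurvature (i : ℕ) (γ : ℝ → R4) (t : ℝ) : ℝ :=
  symplForm (iteratedDeriv i γ t) (iteratedDeriv (i + 1) γ t)

/-- A smooth parameterized curve is Lagrangian if `γ'` and `γ''` are everywhere linearly
independent and `Λ(γ', γ'') = 0`. -/
structure IsLagrangianCurve (γ : ℝ → R4) : Prop where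
  smooth : ContDiff ℝ ∞ γ
  linearIndependent : ∀ t, LinearIndependent ℝ ![iteratedDeriv 1 γ t, iteratedDeriv 2 γ t]
  lagrangian : ∀ t, symplForm (iteratedDeriv 1 γ t) (iteratedDeriv 2 γ t) = 0

/-- The real fifth root, as an odd function on the whole line. -/
noncomputable def fifthRoot (x : ℝ) : ℝ := Real.sign x * |x| ^ (1 / 5 : ℝ)

/-- The density of the symplectic arc-element `σ_γ = Λ(γ'', γ''')^{1/5} dt`. -/
noncomputable def symplArcElement (γ : ℝ → R4) (t : ℝ) : ℝ :=
  fifthRoot (symplForm (iteratedDeriv 2 γ t) (iteratedDeriv 3 γ t))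

/-- `γ` is parameterized by the symplectic arc-length: `σ_γ = dt`. -/
def IsSymplArcLengthParam (γ : ℝ → R4) : Prop :=
  ∀ t, symplArcElement γ t = 1

/-- The symplectic length of the arc `γ([a, b])`. -/
noncomputable def symplLength (γ : ℝ → R4) (a b : ℝ) : ℝ :=
  ∫ t in a..b, symplArcElement γ t

/-- A parameterized curve on the whole line is closed if it is periodic. -/
def IsClosedCurve (γ : ℝ → R4) : Prop :=
  ∃ T : ℝ, 0 < T ∧ Function.Periodic γ T

/-- `T` is the least positive period of `γ`. -/
def IsMinimalPeriod (γ : ℝ → R4) (T : ℝ) : Prop :=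
  IsLeast {P : ℝ | 0 < P ∧ Function.Periodic γ P} T

/-- The point with angular coordinates `(θ₁, θ₂)` on the homogeneous torus
`x₁² + x₃² = r₁²`, `x₂² + x₄² = r₂²`. -/
noncomputable def torusPoint (r₁ r₂ θ₁ θ₂ : ℝ) : R4 :=
  Sum.elim ![r₁ * Real.cos θ₁, r₂ * Real.cos θ₂] ![r₁ * Real.sin θ₁, r₂ * Real.sin θ₂]

/-- A curve of period `T` is a torus knot of type `(m, n)`: it is a simple closed curve lying
on the image of a homogeneous torus (which is a standard torus in a round 3-sphere) under an
affine symplectic transformation, and over one period it winds `m` times around one factor of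
the torus and `n` times around the other. Winding numbers are counted up to sign, so that the
type does not depend on orientations; interchanging the two factors is itself a symplectic
transformation. -/
def IsTorusKnotOfType (γ : ℝ → R4) (T : ℝ) (m n : ℕ) : Prop :=
  0 < T ∧ Function.Periodic γ T ∧ Set.InjOn γ (Set.Ico 0 T) ∧
  ∃ (a : R4) (A : Matrix (Fin 2 ⊕ Fin 2) (Fin 2 ⊕ Fin 2) ℝ) (r₁ r₂ : ℝ) (θ₁ θ₂ : ℝ → ℝ)
    (k₁ k₂ : ℤ),
    A ∈ Matrix.symplecticGroup (Fin 2) ℝ ∧ 0 < r₁ ∧ 0 < r₂ ∧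
    Continuous θ₁ ∧ Continuous θ₂ ∧
    (∀ s, γ s = a + Matrix.mulVec A (torusPoint r₁ r₂ (θ₁ s) (θ₂ s))) ∧
    (∀ s, θ₁ (s + T) = θ₁ s + 2 * Real.pi * k₁) ∧
    (∀ s, θ₂ (s + T) = θ₂ s + 2 * Real.pi * k₂) ∧
    k₁.natAbs = m ∧ k₂.natAbs = n

/-- The positive number `ν`, where `± iμ, ± iν` with `μ > ν > 0` are the roots of
`λ⁴ + κ₃ λ² + κ₃² - κ₄`. -/
noncomputable def lowFrequency (κ₃ κ₄ : ℝ) : ℝ :=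
  √((κ₃ - √(4 * κ₄ - 3 * κ₃ ^ 2)) / 2)

/-! Differentiating the constant products `Λ(γ⁽ⁱ⁾, γ⁽ʲ⁾)` determines the Gram matrix of the
derivatives. Nondegeneracy of `Λ` then gives the linear equation `γ⁽⁵⁾ + κ₃ γ''' + (κ₃² - κ₄) γ' =
0`, with characteristic polynomial `z⁴ + κ₃ z² + κ₃² - κ₄` for `γ'`.

If `γ` has period `T`, then `Λ(γ'(0), γ'(t))` is a periodic solution with initial values `0, 0, 0,
-1`. Such a solution involves every root, so all roots are simple and lie in `(2πi/T)ℤ`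
(`exp_eq_one_of_periodic`, `exists_int_of_exp_eq_one`). Vieta's formulas give the inequalities and
`(*)`.

Conversely, `(*)` makes the roots `±igm, ±ign`, and `γ` is a constant plus two elliptic motions in
`Λ`-orthogonal planes (`HasConstantCurvatures.exists_harmonic`). Normalized axes of the ellipses
form a symplectic matrix, and coprimality gives injectivity on `[0, 2π/g)`
(`isTorusKnotOfType_of_harmonic`). Hence the minimal period, which is also the length, is `2π/g`. -/

/-! ### Symplectic linear algebra -/

theorem symplForm_add_right (X Y Z : R4) :
    symplForm X (Y + Z) = symplForm X Y + symplForm X Z := by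
  simp only [symplForm_apply, Pi.add_apply]; ring

theorem symplForm_smul_right (r : ℝ) (X Y : R4) :
    symplForm X (r • Y) = r * symplForm X Y := by
  simp only [symplForm_apply, Pi.smul_apply, smul_eq_mul]; ring

theorem symplForm_swap (X Y : R4) : symplForm Y X = -symplForm X Y := by
  simp only [symplForm_apply]; ring

theorem symplForm_self (X : R4) : symplForm X X = 0 := by
  simp only [symplForm_apply]; ring

theorem symplForm_add_left (X Y Z : R4) :
    symplForm (X + Y) Z = symplForm X Z + symplForm Y Z := by
  simp only [symplForm_apply, Pi.add_apply]; ring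

theorem symplForm_smul_left (r : ℝ) (X Y : R4) :
    symplForm (r • X) Y = r * symplForm X Y := by
  simp only [symplForm_apply, Pi.smul_apply, smul_eq_mul]; ring

theorem symplForm_zero_right (X : R4) : symplForm X 0 = 0 := by
  simp [symplForm_apply]

theorem HasDerivAt.symplForm {f g : ℝ → R4} {f' g' : R4} {t : ℝ}
    (hf : HasDerivAt f f' t) (hg : HasDerivAt g g' t) :
    HasDerivAt (fun s => symplForm (f s) (g s)) (symplForm f' (g t) + symplForm (f t) g') t := by
  have hf := hasDerivAt_pi.1 hf
  have hg := hasDerivAt_pi.1 hg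
  simp only [symplForm_apply]
  refine HasDerivAt.congr_deriv (((((hf (Sum.inl 0)).fun_mul (hg (Sum.inr 0))).fun_add
    ((hf (Sum.inl 1)).fun_mul (hg (Sum.inr 1)))).fun_sub
    ((hf (Sum.inr 0)).fun_mul (hg (Sum.inl 0)))).fun_sub
    ((hf (Sum.inr 1)).fun_mul (hg (Sum.inl 1)))) ?_
  ring

theorem eq_zero_of_symplForm_eq_zero {X : R4} (h : ∀ Y, symplForm X Y = 0) : X = 0 := by
  have h0 := h (Pi.single (Sum.inl 0) 1)
  have h1 := h (Pi.single (Sum.inl 1) 1)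
  have h2 := h (Pi.single (Sum.inr 0) 1)
  have h3 := h (Pi.single (Sum.inr 1) 1)
  simp [symplForm_apply] at h0 h1 h2 h3
  ext i
  rcases i with i | i <;> fin_cases i <;> simp [*]

/-- A vector orthogonal to four vectors with the Gram matrix of a symplectic Frenet frame is
zero. -/
theorem eq_zero_of_orthogonal_frame {X e₁ e₂ e₃ e₄ : R4} {κ : ℝ}
    (h12 : symplForm e₁ e₂ = 0) (h13 : symplForm e₁ e₃ = 0) (h14 : symplForm e₁ e₄ = -1)
    (h23 : symplForm e₂ e₃ = 1) (h24 : symplForm e₂ e₄ = 0) (h34 : symplForm e₃ e₄ = κ)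
    (h1 : symplForm X e₁ = 0) (h2 : symplForm X e₂ = 0) (h3 : symplForm X e₃ = 0)
    (h4 : symplForm X e₄ = 0) : X = 0 := by
  have hli : LinearIndependent ℝ ![e₁, e₂, e₃, e₄] := by
    rw [Fintype.linearIndependent_iff]
    intro a ha
    simp only [Fin.sum_univ_four] at ha
    simp at ha
    -- Pairing a linear relation with each frame vector gives a triangular system for its
    -- coefficients, so the frame is a basis.
    have key : ∀ Y, a 0 * symplForm Y e₁ + a 1 * symplForm Y e₂ + a 2 * symplForm Y e₃
        + a 3 * symplForm Y e₄ = 0 := fun Y => by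
      simpa only [symplForm_add_right, symplForm_smul_right, symplForm_zero_right] using
        congrArg (symplForm Y) ha
    have k1 := key e₁
    have k2 := key e₂
    have k3 := key e₃
    have k4 := key e₄
    simp only [symplForm_self, symplForm_swap e₁ e₂, symplForm_swap e₁ e₃, symplForm_swap e₁ e₄,
      symplForm_swap e₂ e₃, symplForm_swap e₂ e₄, symplForm_swap e₃ e₄, h12, h13, h14, h23, h24,
      h34] at k1 k2 k3 k4
    have a3 : a 3 = 0 := by linarith
    have a2 : a 2 = 0 := by linarith
    have a1 : a 1 = 0 := by simp [a3] at k3; linarith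
    have a0 : a 0 = 0 := by simp [a2] at k4; linarith
    intro i
    fin_cases i <;> assumption
  have hspan := hli.span_eq_top_of_card_eq_finrank' (by simp)
  refine eq_zero_of_symplForm_eq_zero fun Y => ?_
  have hY : Y ∈ Submodule.span ℝ (Set.range ![e₁, e₂, e₃, e₄]) := hspan ▸ Submodule.mem_top
  induction hY using Submodule.span_induction with
  | mem y hy =>
    obtain ⟨i, rfl⟩ := hy
    fin_cases i <;> assumption
  | zero => exact symplForm_zero_right X
  | add y z _ _ hy hz => rw [symplForm_add_right, hy, hz, add_zero]
  | smul r y _ hy => rw [symplForm_smul_right, hy, mul_zero]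

theorem fifthRoot_eq_one {x : ℝ} (h : fifthRoot x = 1) : x = 1 := by
  unfold fifthRoot at h
  rcases lt_trichotomy x 0 with hx | rfl | hx
  · rw [Real.sign_of_neg hx] at h
    have := Real.rpow_nonneg (abs_nonneg x) (1 / 5 : ℝ)
    linarith
  · simp at h
  · rw [Real.sign_of_pos hx, one_mul, abs_of_pos hx] at h
    exact (Real.rpow_left_inj hx.le zero_le_one (by norm_num)).1 (h.trans (Real.one_rpow _).symm)

/-! ### The structure equation -/

theorem ContDiff.hasDerivAt_iteratedDeriv {E : Type*} [NormedAddCommGroup E] [NormedSpace ℝ E]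
    {γ : ℝ → E} (h : ContDiff ℝ ∞ γ) (i : ℕ) (t : ℝ) :
    HasDerivAt (iteratedDeriv i γ) (iteratedDeriv (i + 1) γ t) t := by
  rw [iteratedDeriv_succ]
  exact ((h.differentiable_iteratedDeriv i (by exact_mod_cast WithTop.coe_lt_top _)) t).hasDerivAt

/-- If `Λ(f, g)` is constant then `Λ(f', g) + Λ(f, g') = 0`. -/
theorem symplForm_deriv_of_const {f g f' g' : ℝ → R4} {c : ℝ}
    (hf : ∀ t, HasDerivAt f (f' t) t) (hg : ∀ t, HasDerivAt g (g' t) t)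
    (h : ∀ t, symplForm (f t) (g t) = c) (t : ℝ) :
    symplForm (f' t) (g t) + symplForm (f t) (g' t) = 0 := by
  have := (hf t).symplForm (hg t)
  rw [funext h] at this
  exact this.unique (hasDerivAt_const t c)

/-- The symplectic products of the derivatives of a Lagrangian curve with constant symplectic
curvatures, parameterized by symplectic arc-length, and its structure equation. -/
structure HasConstantCurvatures (e : ℕ → ℝ → R4) (κ₃ κ₄ : ℝ) : Prop where
  hasDerivAt : ∀ i t, HasDerivAt (e i) (e (i + 1) t) t
  h12 : ∀ t, symplForm (e 1 t) (e 2 t) = 0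
  h13 : ∀ t, symplForm (e 1 t) (e 3 t) = 0
  h14 : ∀ t, symplForm (e 1 t) (e 4 t) = -1
  h23 : ∀ t, symplForm (e 2 t) (e 3 t) = 1
  h24 : ∀ t, symplForm (e 2 t) (e 4 t) = 0
  h34 : ∀ t, symplForm (e 3 t) (e 4 t) = κ₃
  structureEq : ∀ t, e 5 t + κ₃ • e 3 t + (κ₃ ^ 2 - κ₄) • e 1 t = 0

/-- Each constant product, once differentiated, yields the next ones. The left side of the structure
equation is then orthogonal to the frame `e 1, …, e 4`. -/
theorem hasConstantCurvatures_iteratedDeriv {γ : ℝ → R4} {κ₃ κ₄ : ℝ}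
    (hγ : IsLagrangianCurve γ) (harc : IsSymplArcLengthParam γ)
    (h₃ : ∀ s, symplCurvature 3 γ s = κ₃) (h₄ : ∀ s, symplCurvature 4 γ s = κ₄) :
    HasConstantCurvatures (fun i => iteratedDeriv i γ) κ₃ κ₄ := by
  have hd := hγ.smooth.hasDerivAt_iteratedDeriv
  generalize he : (fun i => iteratedDeriv i γ) = e
  have hi : ∀ i, iteratedDeriv i γ = e i := fun i => by rw [← he]
  simp only [symplCurvature, Nat.reduceAdd, hi] at h₃ h₄
  simp only [hi] at hd
  have h12 := hγ.lagrangian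
  have h23 : ∀ t, symplForm (e 2 t) (e 3 t) = 1 := fun t => by
    simpa only [symplArcElement, hi] using fifthRoot_eq_one (harc t)
  simp only [hi] at h12
  have h13 : ∀ t, symplForm (e 1 t) (e 3 t) = 0 := fun t => by
    have := symplForm_deriv_of_const (hd 1) (hd 2) h12 t
    simpa [symplForm_self] using this
  have h14 : ∀ t, symplForm (e 1 t) (e 4 t) = -1 := fun t => by
    have := symplForm_deriv_of_const (hd 1) (hd 3) h13 t
    simp only [Nat.reduceAdd, h23] at this
    linarith
  have h24 : ∀ t, symplForm (e 2 t) (e 4 t) = 0 := fun t => by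
    have := symplForm_deriv_of_const (hd 2) (hd 3) h23 t
    simpa [symplForm_self] using this
  have h15 : ∀ t, symplForm (e 1 t) (e 5 t) = 0 := fun t => by
    have := symplForm_deriv_of_const (hd 1) (hd 4) h14 t
    simpa [h24] using this
  have h25 : ∀ t, symplForm (e 2 t) (e 5 t) = -κ₃ := fun t => by
    have := symplForm_deriv_of_const (hd 2) (hd 4) h24 t
    simp only [Nat.reduceAdd, h₃] at this
    linarith
  have h35 : ∀ t, symplForm (e 3 t) (e 5 t) = 0 := fun t => by
    have := symplForm_deriv_of_const (hd 3) (hd 4) h₃ t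
    simpa [symplForm_self] using this
  refine ⟨hd, h12, h13, h14, h23, h24, h₃, fun t => ?_⟩
  refine eq_zero_of_orthogonal_frame (h12 t) (h13 t) (h14 t) (h23 t) (h24 t) (h₃ t) ?_ ?_ ?_ ?_ <;>
  simp only [symplForm_add_left, symplForm_smul_left, symplForm_self,
    symplForm_swap (e 1 t) (e 5 t), symplForm_swap (e 2 t) (e 5 t), symplForm_swap (e 3 t) (e 5 t),
    symplForm_swap (e 4 t) (e 5 t), symplForm_swap (e 1 t) (e 3 t), symplForm_swap (e 2 t) (e 3 t),
    h12, h13, h14, h15, h23, h25, h35, h₃, h₄] <;> ring_nf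

/-! ### Harmonic motions and torus knots -/

open Real in
-- The phase vector `(αh, h')` rotates with angular speed `α`; rotating it back gives two constants
-- of motion, from which `h` is recovered.
theorem eq_cos_add_sin_of_hasDerivAt {E : Type*} [NormedAddCommGroup E] [NormedSpace ℝ E]
    {h h' : ℝ → E} {α : ℝ} (hα : α ≠ 0)
    (d : ∀ t, HasDerivAt h (h' t) t) (d' : ∀ t, HasDerivAt h' (-α ^ 2 • h t) t) (t : ℝ) :
    h t = cos (α * t) • h 0 + sin (α * t) • α⁻¹ • h' 0 := by
  have hlin : ∀ s : ℝ, HasDerivAt (fun s => α * s) α s := fun s => by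
    simpa using (hasDerivAt_id s).const_mul α
  have hA : ∀ s, HasDerivAt (fun s => (α * cos (α * s)) • h s - sin (α * s) • h' s) 0 s := by
    intro s
    refine HasDerivAt.congr_deriv
      ((((hlin s).cos.const_mul α).fun_smul (d s)).fun_sub ((hlin s).sin.fun_smul (d' s))) ?_
    module
  have hB : ∀ s, HasDerivAt (fun s => (α * sin (α * s)) • h s + cos (α * s) • h' s) 0 s := by
    intro s
    refine HasDerivAt.congr_deriv
      ((((hlin s).sin.const_mul α).fun_smul (d s)).fun_add ((hlin s).cos.fun_smul (d' s))) ?_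
    module
  have cA := is_const_of_deriv_eq_zero (fun s => (hA s).differentiableAt)
    (fun s => (hA s).deriv) t 0
  have cB := is_const_of_deriv_eq_zero (fun s => (hB s).differentiableAt)
    (fun s => (hB s).deriv) t 0
  simp only [mul_zero, cos_zero, sin_zero, mul_one, zero_smul, sub_zero, one_smul, zero_add]
    at cA cB
  rw [← cB]
  have h1 : h 0 = α⁻¹ • ((α * cos (α * t)) • h t - sin (α * t) • h' t) := by
    rw [cA, inv_smul_smul₀ hα]
  rw [h1]
  have e : h t = (α⁻¹ * α * (sin (α * t) ^ 2 + cos (α * t) ^ 2)) • h t := by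
    rw [sin_sq_add_cos_sq, inv_mul_cancel₀ hα]; simp
  nth_rewrite 1 [e]
  module

/-- The matrix with prescribed columns. -/
def matrixOfColumns (C : Fin 2 ⊕ Fin 2 → R4) : Matrix (Fin 2 ⊕ Fin 2) (Fin 2 ⊕ Fin 2) ℝ :=
  Matrix.of fun i j => C j i

theorem matrixOfColumns_mulVec (C : Fin 2 ⊕ Fin 2 → R4) (x : R4) :
    (matrixOfColumns C).mulVec x = x (Sum.inl 0) • C (Sum.inl 0) + x (Sum.inl 1) • C (Sum.inl 1)
      + (x (Sum.inr 0) • C (Sum.inr 0) + x (Sum.inr 1) • C (Sum.inr 1)) := by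
  ext i
  simp [matrixOfColumns, Matrix.mulVec, dotProduct, mul_comm]

theorem matrixOfColumns_mem_symplecticGroup {C : Fin 2 ⊕ Fin 2 → R4}
    (h : ∀ i j, symplForm (C i) (C j) = -Matrix.J (Fin 2) ℝ i j) :
    matrixOfColumns C ∈ Matrix.symplecticGroup (Fin 2) ℝ := by
  rw [SymplecticGroup.mem_iff']
  ext i j
  rw [← neg_inj, ← h i j, Matrix.mul_assoc, Matrix.mul_apply]
  simp only [symplForm, Matrix.neg_mulVec, dotProduct_neg]
  rfl

theorem torusPoint_inj {r₁ r₂ θ₁ θ₂ φ₁ φ₂ : ℝ} (h₁ : r₁ ≠ 0) (h₂ : r₂ ≠ 0)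
    (h : torusPoint r₁ r₂ θ₁ θ₂ = torusPoint r₁ r₂ φ₁ φ₂) :
    (∃ k : ℤ, θ₁ - φ₁ = 2 * Real.pi * k) ∧ ∃ k : ℤ, θ₂ - φ₂ = 2 * Real.pi * k := by
  have a := congrFun h (Sum.inl 0)
  have b := congrFun h (Sum.inl 1)
  have c := congrFun h (Sum.inr 0)
  have d := congrFun h (Sum.inr 1)
  simp only [torusPoint, Sum.elim_inl, Sum.elim_inr, Matrix.cons_val_zero, Matrix.cons_val_one,
    mul_eq_mul_left_iff, h₁, h₂, or_false] at a b c d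
  exact ⟨Real.Angle.angle_eq_iff_two_pi_dvd_sub.1 (Real.Angle.cos_sin_inj a c),
    Real.Angle.angle_eq_iff_two_pi_dvd_sub.1 (Real.Angle.cos_sin_inj b d)⟩

/-- Applied to `d = Λ(P, Q)`: `r` becomes the radius of a torus factor and `ε` the direction of
rotation. -/
theorem exists_sign_mul_eq_sq {d : ℝ} (hd : d ≠ 0) :
    ∃ (ε : ℤ) (r : ℝ), (ε = 1 ∨ ε = -1) ∧ 0 < r ∧ (ε : ℝ) * d = r ^ 2 := by
  rcases hd.lt_or_gt with h | h
  · exact ⟨-1, √(-d), Or.inr rfl, Real.sqrt_pos.2 (by linarith), by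
      rw [Real.sq_sqrt (by linarith)]; simp⟩
  · exact ⟨1, √d, Or.inl rfl, Real.sqrt_pos.2 h, by rw [Real.sq_sqrt h.le]; simp⟩

theorem cos_sign_mul {ε : ℤ} (hε : ε = 1 ∨ ε = -1) (x : ℝ) : Real.cos (ε * x) = Real.cos x := by
  rcases hε with rfl | rfl <;> simp

theorem sin_sign_mul {ε : ℤ} (hε : ε = 1 ∨ ε = -1) (x : ℝ) :
    Real.sin (ε * x) = ε * Real.sin x := by
  rcases hε with rfl | rfl <;> simp

theorem periodic_of_harmonic {γ : ℝ → R4} {a P Q R S : R4} {g : ℝ} {m n : ℕ} (hg : g ≠ 0)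
    (hγ : ∀ s, γ s = a + (Real.cos (g * m * s) • P + Real.sin (g * m * s) • Q
      + (Real.cos (g * n * s) • R + Real.sin (g * n * s) • S))) :
    Function.Periodic γ (2 * Real.pi / g) := fun s => by
  have e1 : g * m * (s + 2 * Real.pi / g) = g * m * s + m * (2 * Real.pi) := by field_simp
  have e2 : g * n * (s + 2 * Real.pi / g) = g * n * s + n * (2 * Real.pi) := by field_simp
  rw [hγ, hγ, e1, e2]
  simp only [Real.cos_add_nat_mul_two_pi, Real.sin_add_nat_mul_two_pi]

/-- A superposition of two harmonic motions in complementary symplectic planes whose frequencies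
are in the ratio `m : n` of coprime numbers is a torus knot. -/
theorem isTorusKnotOfType_of_harmonic {γ : ℝ → R4} {a P Q R S : R4} {g : ℝ} {m n : ℕ}
    (hg : 0 < g) (hmn : Nat.Coprime m n)
    (hγ : ∀ s, γ s = a + (Real.cos (g * m * s) • P + Real.sin (g * m * s) • Q
      + (Real.cos (g * n * s) • R + Real.sin (g * n * s) • S)))
    (hPQ : symplForm P Q ≠ 0) (hRS : symplForm R S ≠ 0)
    (hPR : symplForm P R = 0) (hPS : symplForm P S = 0)
    (hQR : symplForm Q R = 0) (hQS : symplForm Q S = 0) :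
    IsTorusKnotOfType γ (2 * Real.pi / g) m n := by
  obtain ⟨ε, r, hε, hr, hεr⟩ := exists_sign_mul_eq_sq hPQ
  obtain ⟨δ, q, hδ, hq, hδq⟩ := exists_sign_mul_eq_sq hRS
  have hr0 := hr.ne'
  have hq0 := hq.ne'
  -- The sign on `Q` makes `Λ(P/r, εQ/r) = 1`; the same sign in the angle compensates for it, since
  -- `sin` is odd.
  set C : Fin 2 ⊕ Fin 2 → R4 :=
    Sum.elim ![r⁻¹ • P, q⁻¹ • R] ![(ε * r⁻¹) • Q, (δ * q⁻¹) • S] with hC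
  have hA : matrixOfColumns C ∈ Matrix.symplecticGroup (Fin 2) ℝ := by
    have h1 : r⁻¹ * (r⁻¹ * ε * symplForm P Q) = 1 := by
      rw [mul_assoc r⁻¹, hεr]; field_simp
    have h2 : q⁻¹ * (q⁻¹ * δ * symplForm R S) = 1 := by
      rw [mul_assoc q⁻¹, hδq]; field_simp
    refine matrixOfColumns_mem_symplecticGroup fun i j => ?_
    rcases i with i | i <;> rcases j with j | j <;> fin_cases i <;> fin_cases j <;>
    simp [hC, Matrix.J, symplForm_smul_left, symplForm_smul_right, symplForm_self,
      symplForm_swap P Q, symplForm_swap P R, symplForm_swap P S, symplForm_swap Q R,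
      symplForm_swap Q S, symplForm_swap R S, hPR, hPS, hQR, hQS] <;> linarith
  have hform : ∀ s, γ s = a + (matrixOfColumns C).mulVec
      (torusPoint r q (ε * (g * m * s)) (δ * (g * n * s))) := by
    intro s
    have hε2 : (ε : ℝ) * ε = 1 := by rcases hε with rfl | rfl <;> simp
    have hδ2 : (δ : ℝ) * δ = 1 := by rcases hδ with rfl | rfl <;> simp
    rw [hγ, matrixOfColumns_mulVec]
    simp only [torusPoint, hC, Sum.elim_inl, Sum.elim_inr, Matrix.cons_val_zero,
      Matrix.cons_val_one, cos_sign_mul hε, cos_sign_mul hδ, sin_sign_mul hε, sin_sign_mul hδ,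
      smul_smul]
    have e1 : r * Real.cos (g * m * s) * r⁻¹ = Real.cos (g * m * s) := by field_simp
    have e2 : q * Real.cos (g * n * s) * q⁻¹ = Real.cos (g * n * s) := by field_simp
    have e3 : r * (ε * Real.sin (g * m * s)) * (ε * r⁻¹) = Real.sin (g * m * s) := by
      linear_combination (Real.sin (g * m * s)) * (ε * ε) * mul_inv_cancel₀ hr0
        + (Real.sin (g * m * s)) * hε2
    have e4 : q * (δ * Real.sin (g * n * s)) * (δ * q⁻¹) = Real.sin (g * n * s) := by
      linear_combination (Real.sin (g * n * s)) * (δ * δ) * mul_inv_cancel₀ hq0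
        + (Real.sin (g * n * s)) * hδ2
    rw [e1, e2, e3, e4]
    module
  refine ⟨by positivity, periodic_of_harmonic hg.ne' hγ, ?_, a, matrixOfColumns C, r, q,
    fun s => ε * (g * m * s), fun s => δ * (g * n * s), ε * m, δ * n, hA, hr, hq, by fun_prop,
    by fun_prop, hform, fun s => ?_, fun s => ?_, ?_, ?_⟩
  · intro s hs t ht hst
    rw [hform, hform, add_right_inj] at hst
    have hinj := Matrix.mulVec_injective_of_isUnit
      ((Matrix.isUnit_iff_isUnit_det _).2 (SymplecticGroup.symplectic_det hA))
    obtain ⟨⟨j, hj⟩, ⟨k, hk⟩⟩ := torusPoint_inj hr0 hq0 (hinj hst)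
    have hj' : ∃ j : ℤ, g * m * (s - t) = 2 * Real.pi * j := by
      rcases hε with rfl | rfl
      · exact ⟨j, by push_cast at hj; linarith⟩
      · exact ⟨-j, by push_cast at hj ⊢; linarith⟩
    have hk' : ∃ j : ℤ, g * n * (s - t) = 2 * Real.pi * j := by
      rcases hδ with rfl | rfl
      · exact ⟨k, by push_cast at hk; linarith⟩
      · exact ⟨-k, by push_cast at hk ⊢; linarith⟩
    clear hj hk j k
    obtain ⟨j, hj⟩ := hj'
    obtain ⟨k, hk⟩ := hk'
    -- By Bézout, `g(s - t)` itself is an integer multiple of `2π`. It has absolute value less than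
    -- `2π`, so it vanishes.
    have hbez : (m : ℤ) * Nat.gcdA m n + n * Nat.gcdB m n = 1 := by
      rw [← Nat.gcd_eq_gcd_ab, hmn]; rfl
    have hbez' : (m : ℝ) * (Nat.gcdA m n : ℤ) + n * (Nat.gcdB m n : ℤ) = 1 := by
      exact_mod_cast hbez
    set u := Nat.gcdA m n
    set v := Nat.gcdB m n
    have hd : g * (s - t) = 2 * Real.pi * ((j * u + k * v : ℤ) : ℝ) := by
      push_cast
      linear_combination u * hj + v * hk - g * (s - t) * hbez'
    have hlt : ∀ x ∈ Set.Ico 0 (2 * Real.pi / g), 0 ≤ g * x ∧ g * x < 2 * Real.pi := by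
      intro x hx
      refine ⟨mul_nonneg hg.le hx.1, ?_⟩
      have := (lt_div_iff₀ hg).1 hx.2
      linarith
    have hs' := hlt s hs
    have ht' := hlt t ht
    have hpi := Real.pi_pos
    have hz : j * u + k * v = 0 := by
      have h1 : ((j * u + k * v : ℤ) : ℝ) < 1 := by nlinarith
      have h2 : (-1 : ℝ) < ((j * u + k * v : ℤ) : ℝ) := by nlinarith
      have h1' : j * u + k * v < 1 := by exact_mod_cast h1
      have h2' : -1 < j * u + k * v := by exact_mod_cast h2
      omega
    rw [hz, Int.cast_zero, mul_zero, mul_eq_zero] at hd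
    rcases hd with hd | hd
    · exact absurd hd hg.ne'
    · linarith
  · push_cast; field_simp
  · push_cast; field_simp
  · rcases hε with rfl | rfl <;> simp
  · rcases hδ with rfl | rfl <;> simp

/-! ### Characteristic roots of a periodic solution -/

theorem eq_mul_exp_of_hasDerivAt {w : ℝ → ℂ} {z : ℂ}
    (h : ∀ t, HasDerivAt w (z * w t) t) (t : ℝ) : w t = w 0 * Complex.exp (z * t) := by
  have hE : ∀ s : ℝ, HasDerivAt (fun s : ℝ => Complex.exp (-z * s))
      (Complex.exp (-z * s) * -z) s := fun s => by
    simpa using ((Complex.ofRealCLM.hasDerivAt (x := s)).const_mul (-z)).cexp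
  have hd : ∀ s, HasDerivAt (fun s : ℝ => w s * Complex.exp (-z * s)) 0 s := fun s => by
    refine HasDerivAt.congr_deriv ((h s).fun_mul (hE s)) ?_
    ring
  have hc := is_const_of_deriv_eq_zero (fun s => (hd s).differentiableAt) (fun s => (hd s).deriv) t 0
  simp only [Complex.ofReal_zero, mul_zero, Complex.exp_zero, mul_one] at hc
  rw [← hc, mul_assoc, ← Complex.exp_add]
  simp

/-- If `x⁗ + a x'' + b x = 0` has a periodic solution with initial values `0, 0, 0, x₃ ≠ 0`,
every characteristic root `z` satisfies `exp (z T) = 1` and is simple. -/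
theorem exp_eq_one_of_periodic {x : ℕ → ℝ → ℝ} {a b T : ℝ} {z : ℂ} (hT : T ≠ 0)
    (hx : ∀ i t, HasDerivAt (x i) (x (i + 1) t) t)
    (hode : ∀ t, x 4 t + a * x 2 t + b * x 0 t = 0)
    (hper : ∀ i, Function.Periodic (x i) T)
    (h0 : x 0 0 = 0) (h1 : x 1 0 = 0) (h2 : x 2 0 = 0) (h3 : x 3 0 ≠ 0)
    (hz : z ^ 4 + a * z ^ 2 + b = 0) :
    Complex.exp (z * T) = 1 ∧ 4 * z ^ 3 + 2 * a * z ≠ 0 := by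
  have hxc : ∀ i t, HasDerivAt (fun s => (x i s : ℂ)) (x (i + 1) t : ℂ) t :=
    fun i t => (hx i t).ofReal_comp
  have hodec : ∀ t, (x 4 t : ℂ) + a * x 2 t + b * x 0 t = 0 := fun t => by
    exact_mod_cast hode t
  have h3c : (x 3 0 : ℂ) ≠ 0 := by exact_mod_cast h3
  -- The coefficients are those of the quotient of `λ⁴ + aλ² + b` by `λ - z`, so the combination `w`
  -- satisfies `w' = zw`.
  have hw : ∀ t, (x 3 t + z * x 2 t + (z ^ 2 + a) * x 1 t + (z ^ 3 + a * z) * x 0 t : ℂ)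
      = x 3 0 * Complex.exp (z * t) := by
    intro t
    have := eq_mul_exp_of_hasDerivAt (z := z)
      (w := fun t => (x 3 t + z * x 2 t + (z ^ 2 + a) * x 1 t + (z ^ 3 + a * z) * x 0 t : ℂ))
      (fun t => by
        refine HasDerivAt.congr_deriv ((((hxc 3 t).fun_add ((hxc 2 t).const_mul z)).fun_add
          ((hxc 1 t).const_mul (z ^ 2 + a))).fun_add ((hxc 0 t).const_mul (z ^ 3 + a * z))) ?_
        simp only [Nat.reduceAdd]
        linear_combination hodec t - (x 0 t : ℂ) * hz) t
    simpa [h0, h1, h2] using this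
  have hexp : Complex.exp (z * T) = 1 := by
    have hp : ∀ i, x i T = x i 0 := fun i => by simpa using hper i 0
    have := hw T
    simp only [hp] at this
    rw [hw 0] at this
    simpa [h3c] using this
  refine ⟨hexp, fun hdbl => ?_⟩
  have hE : ∀ s : ℝ, HasDerivAt (fun s : ℝ => Complex.exp (-z * s))
      (Complex.exp (-z * s) * -z) s := fun s => by
    simpa using ((Complex.ofRealCLM.hasDerivAt (x := s)).const_mul (-z)).cexp
  -- At a double root one more division by `λ - z` gives `u` with `u' - zu = w`. Then `u exp(-zt)`
  -- grows linearly, while `u` vanishes at `0` and `T`.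
  have hu : ∀ t : ℝ, HasDerivAt (fun t : ℝ => (x 2 t + 2 * z * x 1 t + (3 * z ^ 2 + a) * x 0 t)
      * Complex.exp (-z * t) - x 3 0 * t) 0 t := by
    intro t
    refine HasDerivAt.congr_deriv (((((hxc 2 t).fun_add ((hxc 1 t).const_mul (2 * z))).fun_add
      ((hxc 0 t).const_mul (3 * z ^ 2 + a))).fun_mul (hE t)).fun_sub
      ((Complex.ofRealCLM.hasDerivAt (x := t)).const_mul (x 3 0 : ℂ))) ?_
    have hee : Complex.exp (z * t) * Complex.exp (-z * t) = 1 := by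
      rw [← Complex.exp_add]; simp
    simp only [Nat.reduceAdd, Complex.ofRealCLM_apply, Complex.ofReal_one, mul_one]
    linear_combination Complex.exp (-z * t) * hw t + (x 3 0 : ℂ) * hee
      - (x 0 t : ℂ) * Complex.exp (-z * t) * hdbl
  have hc := is_const_of_deriv_eq_zero (fun s => (hu s).differentiableAt) (fun s => (hu s).deriv) T 0
  have hp : ∀ i, x i T = x i 0 := fun i => by simpa using hper i 0
  simp [hp, h0, h1, h2, h3, hT] at hc

theorem Function.Periodic.of_hasDerivAt {E : Type*} [NormedAddCommGroup E] [NormedSpace ℝ E]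
    {f f' : ℝ → E} {T : ℝ} (h : Function.Periodic f T) (hd : ∀ t, HasDerivAt f (f' t) t) :
    Function.Periodic f' T := fun t => by
  have h1 := (hd (t + T)).comp_add_const t T
  rw [show (fun s => f (s + T)) = f from funext h] at h1
  exact h1.unique (hd t)

/-- A biquadratic polynomial whose roots are all simple and of the form `i τ k`. -/
theorem exists_int_of_exp_eq_one {a b T : ℝ} (hT : 0 < T)
    (h : ∀ z : ℂ, z ^ 4 + a * z ^ 2 + b = 0 →
      Complex.exp (z * T) = 1 ∧ 4 * z ^ 3 + 2 * a * z ≠ 0) :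
    ∃ (τ : ℝ) (k l : ℤ), 0 < τ ∧ k ≠ 0 ∧ l ≠ 0 ∧ (k : ℝ) ^ 2 ≠ (l : ℝ) ^ 2 ∧
      a = τ ^ 2 * (k ^ 2 + l ^ 2) ∧ b = τ ^ 4 * (k ^ 2 * l ^ 2) := by
  have hTc : (T : ℂ) ≠ 0 := by exact_mod_cast hT.ne'
  obtain ⟨s, hs⟩ := IsAlgClosed.exists_pow_nat_eq ((a : ℂ) ^ 2 - 4 * b) two_pos
  obtain ⟨y, hy⟩ := IsAlgClosed.exists_pow_nat_eq ((-a + s) / 2 : ℂ) two_pos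
  obtain ⟨z, hz⟩ := IsAlgClosed.exists_pow_nat_eq ((-a - s) / 2 : ℂ) two_pos
  have hy4 : y ^ 4 + a * y ^ 2 + b = 0 := by
    rw [show y ^ 4 = (y ^ 2) ^ 2 by ring, hy]; linear_combination hs / 4
  have hz4 : z ^ 4 + a * z ^ 2 + b = 0 := by
    rw [show z ^ 4 = (z ^ 2) ^ 2 by ring, hz]; linear_combination hs / 4
  obtain ⟨hy1, hy2⟩ := h y hy4
  obtain ⟨hz1, hz2⟩ := h z hz4
  obtain ⟨k, hk⟩ := Complex.exp_eq_one_iff.1 hy1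
  obtain ⟨l, hl⟩ := Complex.exp_eq_one_iff.1 hz1
  set τ : ℝ := 2 * Real.pi / T with hτ
  have hτc : (τ : ℂ) = 2 * Real.pi / T := by rw [hτ]; push_cast; rfl
  have hyk : y = τ * k * Complex.I := by
    rw [hτc]; field_simp; linear_combination hk
  have hzl : z = τ * l * Complex.I := by
    rw [hτc]; field_simp; linear_combination hl
  have hy' : y ^ 2 = -(τ * k) ^ 2 := by rw [hyk, mul_pow, Complex.I_sq]; ring
  have hz' : z ^ 2 = -(τ * l) ^ 2 := by rw [hzl, mul_pow, Complex.I_sq]; ring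
  have ha : (a : ℂ) = τ ^ 2 * (k ^ 2 + l ^ 2) := by linear_combination hy + hz - hy' - hz'
  have hb : (b : ℂ) = τ ^ 4 * (k ^ 2 * l ^ 2) := by
    rw [hy', ha] at hy4
    rw [show y ^ 4 = (y ^ 2) ^ 2 by ring, hy'] at hy4
    linear_combination hy4
  -- The derivative at a root factors as `2y(2y² + a)`: simplicity excludes both a zero root and
  -- equal squares.
  have hkl : ∀ {y : ℂ}, 4 * y ^ 3 + 2 * a * y ≠ 0 → y ≠ 0 ∧ 2 * y ^ 2 + a ≠ 0 := by
    intro y hy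
    refine ⟨fun h => hy (by rw [h]; ring), fun h => hy (by linear_combination 2 * y * h)⟩
  refine ⟨τ, k, l, by positivity, ?_, ?_, ?_, by exact_mod_cast ha, by exact_mod_cast hb⟩
  · rintro rfl
    exact (hkl hy2).1 (by simp [hyk])
  · rintro rfl
    exact (hkl hz2).1 (by simp [hzl])
  · intro hkl2
    refine (hkl hy2).2 ?_
    have : (k : ℂ) ^ 2 = (l : ℂ) ^ 2 := by exact_mod_cast hkl2
    rw [hy', ha]
    linear_combination -τ ^ 2 * this

/-! ### Integration of the structure equation -/

/-- The structure equation factors as `(D² + α²)(D² + β²)γ' = 0`, so applying `D² + β²` to `γ''`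
leaves only the frequency `α`. -/
theorem HasConstantCurvatures.add_smul_eq_cos_add_sin {e : ℕ → ℝ → R4} {κ₃ κ₄ α β : ℝ}
    (h : HasConstantCurvatures e κ₃ κ₄) (hα : α ≠ 0) (h₃ : κ₃ = α ^ 2 + β ^ 2)
    (h₄ : κ₃ ^ 2 - κ₄ = α ^ 2 * β ^ 2) (s : ℝ) :
    e 4 s + β ^ 2 • e 2 s = Real.cos (α * s) • (e 4 0 + β ^ 2 • e 2 0)
      + Real.sin (α * s) • -α • (e 3 0 + β ^ 2 • e 1 0) := by
  have hd := h.hasDerivAt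
  have key := eq_cos_add_sin_of_hasDerivAt hα (h := fun t => e 4 t + β ^ 2 • e 2 t)
    (h' := fun t => -α ^ 2 • (e 3 t + β ^ 2 • e 1 t))
    (fun t => ((hd 4 t).fun_add ((hd 2 t).const_smul (β ^ 2))).congr_deriv (by
      have := h.structureEq t
      rw [h₄, h₃] at this
      rw [add_assoc] at this
      rw [eq_neg_of_add_eq_zero_left this]
      module))
    (fun t => ((hd 3 t).fun_add ((hd 1 t).const_smul (β ^ 2))).const_smul (-α ^ 2)) s
  rw [key, smul_smul α⁻¹]
  congr 3
  field_simp

/-- The explicit form of the curves with constant symplectic curvatures in the elliptic case. -/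
theorem HasConstantCurvatures.exists_harmonic {e : ℕ → ℝ → R4} {κ₃ κ₄ α β : ℝ}
    (h : HasConstantCurvatures e κ₃ κ₄) (hα : α ≠ 0) (hβ : β ≠ 0) (hne : α ^ 2 ≠ β ^ 2)
    (h₃ : κ₃ = α ^ 2 + β ^ 2) (h₄ : κ₃ ^ 2 - κ₄ = α ^ 2 * β ^ 2) :
    ∃ a P Q R S : R4, (∀ s, e 0 s = a + (Real.cos (α * s) • P + Real.sin (α * s) • Q
      + (Real.cos (β * s) • R + Real.sin (β * s) • S))) ∧
      symplForm P Q ≠ 0 ∧ symplForm R S ≠ 0 ∧ symplForm P R = 0 ∧ symplForm P S = 0 ∧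
      symplForm Q R = 0 ∧ symplForm Q S = 0 := by
  have hd := h.hasDerivAt
  have hba : β ^ 2 - α ^ 2 ≠ 0 := sub_ne_zero.2 hne.symm
  -- This is the structure equation integrated once; the constant is the center of the curve.
  have hc : ∀ t, HasDerivAt
      (fun t => e 0 t + (α ^ 2 * β ^ 2)⁻¹ • (e 4 t + (α ^ 2 + β ^ 2) • e 2 t)) 0 t := fun t => by
    refine ((hd 0 t).fun_add (((hd 4 t).fun_add
      ((hd 2 t).const_smul (α ^ 2 + β ^ 2))).const_smul (α ^ 2 * β ^ 2)⁻¹)).congr_deriv ?_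
    have := h.structureEq t
    rw [h₄, h₃] at this
    simp only [zero_add, Nat.reduceAdd]
    rw [eq_neg_of_add_eq_zero_left this, smul_neg, inv_smul_smul₀ (by positivity), add_neg_cancel]
  have hconst := fun s => is_const_of_deriv_eq_zero (fun s => (hc s).differentiableAt)
    (fun s => (hc s).deriv) s 0
  set a := e 0 0 + (α ^ 2 * β ^ 2)⁻¹ • (e 4 0 + (α ^ 2 + β ^ 2) • e 2 0)
  have hp := h.add_smul_eq_cos_add_sin hα h₃ h₄
  have hq := h.add_smul_eq_cos_add_sin hβ (h₃.trans (add_comm _ _)) (h₄.trans (mul_comm _ _))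
  -- Partial fractions: `k` and `l` solve `c1` and `c2`, which express `e 0 - a` through the two
  -- pure harmonics.
  set k := -(α ^ 2 * (β ^ 2 - α ^ 2))⁻¹ with hk
  set l := (β ^ 2 * (β ^ 2 - α ^ 2))⁻¹ with hl
  have hk0 : k ≠ 0 := neg_ne_zero.2 (inv_ne_zero (by positivity))
  have hl0 : l ≠ 0 := inv_ne_zero (by positivity)
  clear_value k l
  have e13 := symplForm_swap (e 1 0) (e 3 0)
  have e12 := symplForm_swap (e 1 0) (e 2 0)
  have e14 := symplForm_swap (e 1 0) (e 4 0)
  have e23 := symplForm_swap (e 2 0) (e 3 0)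
  have e24 := symplForm_swap (e 2 0) (e 4 0)
  have e34 := symplForm_swap (e 3 0) (e 4 0)
  rw [h.h13] at e13
  rw [h.h12] at e12
  rw [h.h14] at e14
  rw [h.h23] at e23
  rw [h.h24] at e24
  rw [h.h34] at e34
  refine ⟨a, k • (e 4 0 + β ^ 2 • e 2 0), k • -α • (e 3 0 + β ^ 2 • e 1 0),
    l • (e 4 0 + α ^ 2 • e 2 0), l • -β • (e 3 0 + α ^ 2 • e 1 0), fun s => ?_, ?_⟩
  · have h1 : e 0 s = a + (k • (e 4 s + β ^ 2 • e 2 s) + l • (e 4 s + α ^ 2 • e 2 s)) := by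
      rw [← hconst s]
      have c1 : (α ^ 2 * β ^ 2)⁻¹ + k + l = 0 := by rw [hk, hl]; field_simp; ring
      have c2 : (α ^ 2 * β ^ 2)⁻¹ * (α ^ 2 + β ^ 2) + k * β ^ 2 + l * α ^ 2 = 0 := by
        rw [hk, hl]; field_simp; ring
      have : e 0 s = e 0 s + ((α ^ 2 * β ^ 2)⁻¹ + k + l) • e 4 s
          + ((α ^ 2 * β ^ 2)⁻¹ * (α ^ 2 + β ^ 2) + k * β ^ 2 + l * α ^ 2) • e 2 s := by
        rw [c1, c2]; simp
      exact this.trans (by module)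
    rw [h1, hp, hq]
    module
  · simp only [symplForm_add_left, symplForm_add_right, symplForm_smul_left,
      symplForm_smul_right, h.h12, h.h13, h.h14, h.h23, h.h24, h.h34, e13, e12, e14, e23, e24, e34,
      symplForm_self]
    refine ⟨?_, ?_, ?_, ?_, ?_, ?_⟩
    · refine ne_of_eq_of_ne (b := k * (k * (-α * (β ^ 2 - α ^ 2)))) (by rw [h₃]; ring) ?_
      exact mul_ne_zero hk0 (mul_ne_zero hk0 (mul_ne_zero (neg_ne_zero.2 hα) hba))
    · refine ne_of_eq_of_ne (b := l * (l * (β * (β ^ 2 - α ^ 2)))) (by rw [h₃]; ring) ?_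
      exact mul_ne_zero hl0 (mul_ne_zero hl0 (mul_ne_zero hβ hba))
    all_goals subst h₃; ring

theorem HasConstantCurvatures.exists_int_of_periodic {e : ℕ → ℝ → R4} {κ₃ κ₄ T : ℝ}
    (h : HasConstantCurvatures e κ₃ κ₄) (hT : 0 < T) (hper : Function.Periodic (e 0) T) :
    ∃ (τ : ℝ) (k l : ℤ), 0 < τ ∧ k ≠ 0 ∧ l ≠ 0 ∧ (k : ℝ) ^ 2 ≠ (l : ℝ) ^ 2 ∧
      κ₃ = τ ^ 2 * (k ^ 2 + l ^ 2) ∧ κ₃ ^ 2 - κ₄ = τ ^ 4 * (k ^ 2 * l ^ 2) := by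
  have hpi : ∀ i, Function.Periodic (e i) T := fun i => by
    induction i with
    | zero => exact hper
    | succ i ih => exact ih.of_hasDerivAt (h.hasDerivAt i)
  refine exists_int_of_exp_eq_one hT fun z hz => ?_
  -- Pairing with the fixed vector `e 1 0` gives initial values `0, 0, 0, -1` by the Gram relations.
  refine exp_eq_one_of_periodic (x := fun i t => symplForm (e 1 0) (e (i + 1) t)) hT.ne'
    (fun i t => ?_) (fun t => ?_) (fun i t => ?_) (symplForm_self _) (h.h12 0) (h.h13 0) ?_ hz
  · simpa [symplForm_apply] using (hasDerivAt_const t (e 1 0)).symplForm (h.hasDerivAt (i + 1) t)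
  · simpa only [symplForm_add_right, symplForm_smul_right, symplForm_zero_right] using
      congrArg (symplForm (e 1 0)) (h.structureEq t)
  · simp only [hpi (i + 1) t]
  · simp [h.h14]

/-! ### Arithmetic of the frequencies -/

theorem closed_condition_iff {κ₃ κ₄ : ℝ} {m n : ℕ} (hm : 0 < m) (hn : 0 < n) :
    κ₃ ^ 2 / ((m : ℝ) ^ 2 + (n : ℝ) ^ 2) ^ 2 =
      κ₄ / ((m : ℝ) ^ 4 + (m : ℝ) ^ 2 * (n : ℝ) ^ 2 + (n : ℝ) ^ 4) ↔
    κ₃ ^ 2 * ((m : ℝ) ^ 4 + (m : ℝ) ^ 2 * (n : ℝ) ^ 2 + (n : ℝ) ^ 4) =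
      κ₄ * ((m : ℝ) ^ 2 + (n : ℝ) ^ 2) ^ 2 :=
  div_eq_div_iff (by positivity) (by positivity)

/-- The sum of squares forces `g² = κ₃/(m² + n²)`, and `(*)` then gives the product. Equal
frequencies would mean `κ₄ = ¾κ₃²`. -/
theorem exists_frequencies {κ₃ κ₄ : ℝ} {m n : ℕ} (hm : 0 < m) (hn : 0 < n) (h₃ : 0 < κ₃)
    (h₄ : 3 / 4 * κ₃ ^ 2 < κ₄)
    (h : κ₃ ^ 2 / ((m : ℝ) ^ 2 + (n : ℝ) ^ 2) ^ 2 =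
      κ₄ / ((m : ℝ) ^ 4 + (m : ℝ) ^ 2 * (n : ℝ) ^ 2 + (n : ℝ) ^ 4)) :
    ∃ g : ℝ, 0 < g ∧ κ₃ = (g * m) ^ 2 + (g * n) ^ 2 ∧ κ₃ ^ 2 - κ₄ = (g * m) ^ 2 * (g * n) ^ 2 ∧
      (g * m) ^ 2 ≠ (g * n) ^ 2 := by
  have hm' : (0 : ℝ) < m := by exact_mod_cast hm
  have hn' : (0 : ℝ) < n := by exact_mod_cast hn
  rw [closed_condition_iff hm hn] at h
  have hg : √(κ₃ / ((m : ℝ) ^ 2 + (n : ℝ) ^ 2)) ^ 2 = κ₃ / ((m : ℝ) ^ 2 + (n : ℝ) ^ 2) :=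
    Real.sq_sqrt (by positivity)
  have hg0 : 0 < √(κ₃ / ((m : ℝ) ^ 2 + (n : ℝ) ^ 2)) := Real.sqrt_pos.2 (by positivity)
  generalize √(κ₃ / ((m : ℝ) ^ 2 + (n : ℝ) ^ 2)) = g at hg hg0
  have e3 : κ₃ = (g * m) ^ 2 + (g * n) ^ 2 := by
    rw [mul_pow, mul_pow, hg]; field_simp
  have e4 : κ₃ ^ 2 - κ₄ = (g * m) ^ 2 * (g * n) ^ 2 := by
    have hne : ((m : ℝ) ^ 2 + (n : ℝ) ^ 2) ^ 2 ≠ 0 := by positivity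
    apply mul_right_cancel₀ hne
    rw [sub_mul, ← h, e3]
    ring
  refine ⟨g, hg0, e3, e4, fun heq => ?_⟩
  nlinarith

/-- The discriminant is the square of `(gm)² - (gn)²`, so the smaller root of the quadratic is the
smaller of the two squares. -/
theorem lowFrequency_eq {κ₃ κ₄ g : ℝ} {m n : ℕ} (hg : 0 < g)
    (h₃ : κ₃ = (g * m) ^ 2 + (g * n) ^ 2) (h₄ : κ₃ ^ 2 - κ₄ = (g * m) ^ 2 * (g * n) ^ 2) :
    lowFrequency κ₃ κ₄ = g * (min m n : ℕ) := by
  have hD : 4 * κ₄ - 3 * κ₃ ^ 2 = ((g * m) ^ 2 - (g * n) ^ 2) ^ 2 := by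
    have : κ₄ = κ₃ ^ 2 - (g * m) ^ 2 * (g * n) ^ 2 := by linarith
    rw [this, h₃]; ring
  rw [lowFrequency, hD, Real.sqrt_sq_eq_abs, h₃]
  rcases le_total m n with hmn | hmn
  · have hle : (g * m) ^ 2 ≤ (g * n) ^ 2 := by gcongr
    rw [min_eq_left hmn, abs_of_nonpos (by linarith)]
    refine Eq.trans ?_ (Real.sqrt_sq (by positivity : 0 ≤ g * m))
    congr 1
    ring
  · have hle : (g * n) ^ 2 ≤ (g * m) ^ 2 := by gcongr
    rw [min_eq_right hmn, abs_of_nonneg (by linarith)]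
    refine Eq.trans ?_ (Real.sqrt_sq (by positivity : 0 ≤ g * n))
    congr 1
    ring

theorem symplLength_of_arcLength {γ : ℝ → R4} (h : IsSymplArcLengthParam γ) (a b : ℝ) :
    symplLength γ a b = b - a := by
  simp [symplLength, funext h]

theorem IsTorusKnotOfType.isMinimalPeriod {γ : ℝ → R4} {T : ℝ} {m n : ℕ}
    (h : IsTorusKnotOfType γ T m n) : IsMinimalPeriod γ T := by
  obtain ⟨hT, hper, hinj, -⟩ := h
  refine ⟨⟨hT, hper⟩, fun P hP => ?_⟩
  by_contra! hlt
  have h0 : γ P = γ 0 := by simpa using hP.2 0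
  exact hP.1.ne' (hinj ⟨hP.1.le, hlt⟩ ⟨le_rfl, hT⟩ h0)

/-! ### The main theorem -/

theorem mainTheorem3 (γ : ℝ → R4) (κ₃ κ₄ : ℝ)
    (hγ : IsLagrangianCurve γ) (harc : IsSymplArcLengthParam γ)
    (h₃ : ∀ s, symplCurvature 3 γ s = κ₃) (h₄ : ∀ s, symplCurvature 4 γ s = κ₄) :
    (IsClosedCurve γ ↔
      0 < κ₃ ∧ κ₄ < κ₃ ^ 2 ∧ 3 / 4 * κ₃ ^ 2 < κ₄ ∧
        ∃ m n : ℕ, 0 < m ∧ 0 < n ∧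
          κ₃ ^ 2 / ((m : ℝ) ^ 2 + (n : ℝ) ^ 2) ^ 2 =
            κ₄ / ((m : ℝ) ^ 4 + (m : ℝ) ^ 2 * (n : ℝ) ^ 2 + (n : ℝ) ^ 4)) ∧
    (IsClosedCurve γ → ∀ m n : ℕ, 0 < m → 0 < n → Nat.Coprime m n →
      κ₃ ^ 2 / ((m : ℝ) ^ 2 + (n : ℝ) ^ 2) ^ 2 =
        κ₄ / ((m : ℝ) ^ 4 + (m : ℝ) ^ 2 * (n : ℝ) ^ 2 + (n : ℝ) ^ 4) →
      ∃ T : ℝ, IsMinimalPeriod γ T ∧ IsTorusKnotOfType γ T m n ∧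
        symplLength γ 0 T =
          2 * Real.pi * (Nat.lcm m n : ℝ) / (lowFrequency κ₃ κ₄ * (max m n : ℕ))) := by
  have hcc := hasConstantCurvatures_iteratedDeriv hγ harc h₃ h₄
  have hform : ∀ {m n : ℕ} {g : ℝ}, 0 < m → 0 < n → 0 < g →
      κ₃ = (g * m) ^ 2 + (g * n) ^ 2 → κ₃ ^ 2 - κ₄ = (g * m) ^ 2 * (g * n) ^ 2 →
      (g * m) ^ 2 ≠ (g * n) ^ 2 →
      ∃ a P Q R S : R4, (∀ s, γ s = a + (Real.cos (g * m * s) • P + Real.sin (g * m * s) • Q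
        + (Real.cos (g * n * s) • R + Real.sin (g * n * s) • S))) ∧
        symplForm P Q ≠ 0 ∧ symplForm R S ≠ 0 ∧ symplForm P R = 0 ∧ symplForm P S = 0 ∧
        symplForm Q R = 0 ∧ symplForm Q S = 0 := fun {m n g} hm hn hg e3 e4 hne => by
    have hm' : (m : ℝ) ≠ 0 := by exact_mod_cast hm.ne'
    have hn' : (n : ℝ) ≠ 0 := by exact_mod_cast hn.ne'
    simpa only [iteratedDeriv_zero] using
      hcc.exists_harmonic (mul_ne_zero hg.ne' hm') (mul_ne_zero hg.ne' hn') hne e3 e4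
  have hnec : IsClosedCurve γ → 0 < κ₃ ∧ κ₄ < κ₃ ^ 2 ∧ 3 / 4 * κ₃ ^ 2 < κ₄ ∧
      ∃ m n : ℕ, 0 < m ∧ 0 < n ∧
        κ₃ ^ 2 / ((m : ℝ) ^ 2 + (n : ℝ) ^ 2) ^ 2 =
          κ₄ / ((m : ℝ) ^ 4 + (m : ℝ) ^ 2 * (n : ℝ) ^ 2 + (n : ℝ) ^ 4) := by
    rintro ⟨T, hT, hper⟩
    obtain ⟨τ, k, l, hτ, hk, hl, hkl, e3, e4⟩ :=
      hcc.exists_int_of_periodic hT (by simpa only [iteratedDeriv_zero] using hper)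
    have hk2 : (0 : ℝ) < (k : ℝ) ^ 2 := by positivity
    have hl2 : (0 : ℝ) < (l : ℝ) ^ 2 := by positivity
    have hk4 : (0 : ℝ) < ((k : ℝ) ^ 2 - (l : ℝ) ^ 2) ^ 2 := by
      have := sub_ne_zero.2 hkl
      positivity
    -- This is the source of `(*)`: `κ₃²` and `κ₄` are the two denominators, at `k` and `l`, times
    -- the common factor `τ⁴`.
    have e4' : κ₄ = τ ^ 4 * (k ^ 4 + k ^ 2 * l ^ 2 + l ^ 4) := by
      rw [e3] at e4; linear_combination -e4
    have h34 : κ₄ - 3 / 4 * κ₃ ^ 2 = τ ^ 4 / 4 * ((k : ℝ) ^ 2 - (l : ℝ) ^ 2) ^ 2 := by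
      rw [e4', e3]; ring
    refine ⟨by rw [e3]; positivity, ?_, ?_, k.natAbs, l.natAbs, Int.natAbs_pos.2 hk,
      Int.natAbs_pos.2 hl, ?_⟩
    · have : 0 < κ₃ ^ 2 - κ₄ := by rw [e4]; positivity
      linarith
    · have : 0 < κ₄ - 3 / 4 * κ₃ ^ 2 := by rw [h34]; positivity
      linarith
    · rw [closed_condition_iff (Int.natAbs_pos.2 hk) (Int.natAbs_pos.2 hl)]
      have a2 : ∀ j : ℤ, ((j.natAbs : ℕ) : ℝ) ^ 2 = (j : ℝ) ^ 2 := fun j => by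
        rw [Nat.cast_natAbs, Int.cast_abs, sq_abs]
      have a4 : ∀ j : ℤ, ((j.natAbs : ℕ) : ℝ) ^ 4 = (j : ℝ) ^ 4 := fun j => by
        rw [show (4 : ℕ) = 2 * 2 by rfl, pow_mul, a2, ← pow_mul]
      rw [a2, a2, a4, a4, e4', e3]
      ring
  refine ⟨⟨hnec, ?_⟩, fun hclosed m n hm hn hmn heq => ?_⟩
  · rintro ⟨p3, -, p34, m, n, hm, hn, heq⟩
    obtain ⟨g, hg, e3, e4, hne⟩ := exists_frequencies hm hn p3 p34 heq
    obtain ⟨a, P, Q, R, S, hs, -⟩ := hform hm hn hg e3 e4 hne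
    exact ⟨2 * Real.pi / g, by positivity, periodic_of_harmonic hg.ne' hs⟩
  · obtain ⟨p3, -, p34, -⟩ := hnec hclosed
    obtain ⟨g, hg, e3, e4, hne⟩ := exists_frequencies hm hn p3 p34 heq
    obtain ⟨a, P, Q, R, S, hs, hPQ, hRS, hPR, hPS, hQR, hQS⟩ := hform hm hn hg e3 e4 hne
    have hknot := isTorusKnotOfType_of_harmonic hg hmn hs hPQ hRS hPR hPS hQR hQS
    refine ⟨_, hknot.isMinimalPeriod, hknot, ?_⟩
    -- As `ν = g min(m, n)` and `lcm(m, n) = mn`, this identity turns the stated length into `2π/g`.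
    have hmm : ((min m n : ℕ) : ℝ) * (max m n : ℕ) = m * n := by
      exact_mod_cast min_mul_max m n
    have hm' : (m : ℝ) ≠ 0 := by exact_mod_cast hm.ne'
    have hn' : (n : ℝ) ≠ 0 := by exact_mod_cast hn.ne'
    rw [symplLength_of_arcLength harc, lowFrequency_eq hg e3 e4, hmn.lcm_eq_mul, mul_assoc g, hmm,
      Nat.cast_mul]
    field_simp
    ring
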